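/- All graphs are finite and simple. A magic unitary is a matrix whose entries are self-adjoint projections in a unital $C^*$-algebra and each of whose rows and columns sums to $1$. For a graph $X$ with vertex set $V(X)$ and edge set $E(X)$, let $C(\mathrm{Qut}(X))$ be the universal unital $C^*$-algebra generated by the entries of a magic unitary $u=[u_{ij}]_{i,j\in V(X)}$ subject to the relations $u_{ij}u_{k\ell}=0$ whenever $ik\in E(X)$ and $j\ell\notin E(X)$, or $ik\notin E(X)$ and $j\ell\in E(X)$. The graph $X$ is called quantum vertex transitive if $u_{ij}\neq 0$ for all $i,j\in V(X)$. Two graphs $X$ and $X'$ with adjacency matrices $A_X$ and $A_{X'}$ are called quantum isomorphic if there are a nonzero unital $C^*$-algebra $\mathcal{A}$ and a magic unitary $w=[w_{xx'}]_{x\in V(X),\,x'\in V(X')}$ with entries in $\mathcal{A}$ such that $A_Xw=wA_{X'}$. **Lemma.** Let $Y$ be a disconnected quantum vertex transitive graph, and let $Y_1,\dots,Y_\beta$ be the connected components of $Y$. Then $Y=\bigcup_{i=1}^{\beta}Y_i$, and the following hold: 1. each connected component $Y_i$ is quantum vertex transitive; 2. the connected components of $Y$ are pairwise quantum isomorphic,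 that is, $Y_i$ and $Y_j$ are quantum isomorphic for all $i\neq j$. -/

import Mathlib

universe u v

noncomputable section

/-! ### The free unital star-algebra on a set of generators -/

/-- The free unital complex star-algebra on generators `g i`, `i : ι`: noncommutative complex
polynomials in the letters `g i` (the left copy of `ι`) and `(g i)⋆` (the right copy). The star is
conjugate-linear, reverses products and exchanges the two copies; it differs from the linear star
that Mathlib puts on `FreeAlgebra`, whence the separate type. -/
def FreeStarAlgebra (ι : Type u) : Type u := FreeAlgebra ℂ (ι ⊕ ι)

namespace FreeStarAlgebra

variable {ι : Type u}

instance : Ring (FreeStarAlgebra ι) := inferInstanceAs (Ring (FreeAlgebra ℂ (ι ⊕ ι)))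

instance : Algebra ℂ (FreeStarAlgebra ι) := inferInstanceAs (Algebra ℂ (FreeAlgebra ℂ (ι ⊕ ι)))

/-- The letter of the free star-algebra given by an element of `ι ⊕ ι`. -/
def letter (s : ι ⊕ ι) : FreeStarAlgebra ι := FreeAlgebra.ι ℂ s

/-- The generator `g i`. -/
def gen (i : ι) : FreeStarAlgebra ι := letter (Sum.inl i)

theorem induction {motive : FreeStarAlgebra ι → Prop}
    (scalar : ∀ z : ℂ, motive (algebraMap ℂ _ z)) (letter : ∀ s, motive (letter s))
    (mul : ∀ a b, motive a → motive b → motive (a * b))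
    (add : ∀ a b, motive a → motive b → motive (a + b)) (a : FreeStarAlgebra ι) : motive a :=
  FreeAlgebra.induction ℂ (ι ⊕ ι) (motive := motive) scalar letter mul add a

/-- The complex-conjugate algebra structure on the opposite of the free star-algebra. -/
@[reducible] def conjOpAlgebra (ι : Type u) : Algebra ℂ (FreeStarAlgebra ι)ᵐᵒᵖ :=
  ((algebraMap ℂ (FreeStarAlgebra ι)ᵐᵒᵖ).comp (starRingEnd ℂ)).toAlgebra'
    fun z x => Algebra.commutes (starRingEnd ℂ z) x

/-- The star operation, as a ring homomorphism to the opposite ring. -/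
def starHom (ι : Type u) : FreeStarAlgebra ι →+* (FreeStarAlgebra ι)ᵐᵒᵖ :=
  letI := conjOpAlgebra ι
  (FreeAlgebra.lift ℂ (A := (FreeStarAlgebra ι)ᵐᵒᵖ)
    fun s : ι ⊕ ι => MulOpposite.op (letter s.swap)).toRingHom

theorem starHom_letter (s : ι ⊕ ι) :
    starHom ι (letter s) = MulOpposite.op (letter s.swap) := by
  let := conjOpAlgebra ι
  exact FreeAlgebra.lift_ι_apply (R := ℂ) (A := (FreeStarAlgebra ι)ᵐᵒᵖ)
    (fun s : ι ⊕ ι => MulOpposite.op (letter s.swap)) s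

theorem starHom_algebraMap (z : ℂ) :
    starHom ι (algebraMap ℂ _ z) = MulOpposite.op (algebraMap ℂ _ (starRingEnd ℂ z)) := by
  let := conjOpAlgebra ι
  exact (FreeAlgebra.lift ℂ (A := (FreeStarAlgebra ι)ᵐᵒᵖ)
    fun s : ι ⊕ ι => MulOpposite.op (letter s.swap)).commutes z

instance : StarRing (FreeStarAlgebra ι) where
  star a := (starHom ι a).unop
  star_involutive a := by
    induction a using induction with
    | scalar z => simp [starHom_algebraMap]
    | letter s => simp [starHom_letter]
    | mul a b ha hb => simp [ha, hb]
    | add a b ha hb => simp [ha, hb]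
  star_mul a b := by simp
  star_add a b := by simp

theorem star_letter (s : ι ⊕ ι) : star (letter s) = letter s.swap := by
  change (starHom ι (letter s)).unop = _
  rw [starHom_letter, MulOpposite.unop_op]

theorem star_scalar (z : ℂ) :
    star (algebraMap ℂ (FreeStarAlgebra ι) z) = algebraMap ℂ _ (star z) := by
  change (starHom ι (algebraMap ℂ _ z)).unop = _
  rw [starHom_algebraMap, MulOpposite.unop_op]
  rfl

instance : StarModule ℂ (FreeStarAlgebra ι) where
  star_smul z a := by
    rw [Algebra.smul_def, star_mul, star_scalar, Algebra.smul_def, Algebra.commutes]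

variable {B : Type v} [CStarAlgebra B]

/-- The value of each letter when the generators are replaced by elements `T i`. -/
def letterValue (T : ι → B) : ι ⊕ ι → B := Sum.elim T fun i => star (T i)

/-- Substitution of elements `T i` of a unital C⋆-algebra for the generators. -/
def evalAlgHom (T : ι → B) : FreeStarAlgebra ι →ₐ[ℂ] B :=
  FreeAlgebra.lift ℂ (X := ι ⊕ ι) (letterValue T)

theorem evalAlgHom_letter (T : ι → B) (s : ι ⊕ ι) :
    evalAlgHom T (letter s) = letterValue T s :=
  FreeAlgebra.lift_ι_apply (R := ℂ) (letterValue T) s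

/-- Substitution as a unital star-homomorphism. -/
def eval (T : ι → B) : FreeStarAlgebra ι →⋆ₐ[ℂ] B :=
  { evalAlgHom T with
    map_star' := fun a => by
      change evalAlgHom T (star a) = star (evalAlgHom T a)
      induction a using induction with
      | scalar z => rw [star_scalar, AlgHom.commutes, AlgHom.commutes, algebraMap_star_comm]
      | letter s => cases s <;> simp [star_letter, evalAlgHom_letter, letterValue]
      | mul a b ha hb => simp [ha, hb]
      | add a b ha hb => simp [ha, hb] }

theorem eval_letter (T : ι → B) (s : ι ⊕ ι) : eval T (letter s) = letterValue T s :=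
  evalAlgHom_letter T s

theorem eval_gen (T : ι → B) (i : ι) : eval T (gen i) = T i :=
  eval_letter T (Sum.inl i)

end FreeStarAlgebra

/-! ### Universal unital C⋆-algebras given by generators and relations -/

open FreeStarAlgebra in
/-- A presentation `(G | R)` of a universal unital C⋆-algebra: a set of star-polynomials that are
required to vanish, such that each generator is uniformly bounded over all families of elements
of unital C⋆-algebras satisfying the relations. -/
structure CStarPresentation (ι : Type u) where
  /-- The star-polynomials required to vanish. -/
  rels : Set (FreeStarAlgebra ι)
  /-- The generators are uniformly bounded over all representations. -/
  bounded : ∀ i, ∃ C : ℝ, ∀ (B : Type u) [CStarAlgebra B] (T : ι → B),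
    (∀ r ∈ rels, eval T r = 0) → ‖T i‖ ≤ C

namespace CStarPresentation

open FreeStarAlgebra

variable {ι : Type u} (P : CStarPresentation ι)

/-- A family of elements of a unital C⋆-algebra is a representation of `(G | R)` if it satisfies
the relations. -/
def IsRep {B : Type v} [CStarAlgebra B] (T : ι → B) : Prop := ∀ r ∈ P.rels, eval T r = 0

/-- The values `‖π x‖`, where `π` runs over the representations of `(G | R)`. -/
def normValues (x : FreeStarAlgebra ι) : Set ℝ :=
  {c | ∃ (B : Type u) (_ : CStarAlgebra B) (T : ι → B), P.IsRep T ∧ c = ‖eval T x‖}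

/-- `‖x‖ = sup {‖π x‖ : π is a representation of (G | R)}`. -/
def univNorm (x : FreeStarAlgebra ι) : ℝ := sSup (P.normValues x)

theorem bddAbove_normValues (x : FreeStarAlgebra ι) : BddAbove (P.normValues x) := by
  suffices h : ∃ C : ℝ, ∀ (B : Type u) (_ : CStarAlgebra B) (T : ι → B), P.IsRep T →
      ‖eval T x‖ ≤ C by
    obtain ⟨C, hC⟩ := h
    refine ⟨C, ?_⟩
    rintro _ ⟨B, _, T, hT, rfl⟩
    exact hC B _ T hT
  induction x using induction with
  | scalar z =>
    refine ⟨‖z‖, fun B _ T _ => ?_⟩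
    have h : eval T (algebraMap ℂ _ z) = algebraMap ℂ B z := AlgHomClass.commutes (eval T) z
    rw [h]
    rcases subsingleton_or_nontrivial B with hB | hB
    · rw [Subsingleton.elim (algebraMap ℂ B z) 0, norm_zero]
      exact norm_nonneg z
    · exact (norm_algebraMap' B z).le
  | letter s =>
    rcases s with i | i
    · obtain ⟨C, hC⟩ := P.bounded i
      refine ⟨C, fun B _ T hT => ?_⟩
      rw [eval_letter]
      exact hC B T hT
    · obtain ⟨C, hC⟩ := P.bounded i
      refine ⟨C, fun B _ T hT => ?_⟩
      rw [eval_letter]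
      exact (norm_star (T i)).trans_le (hC B T hT)
  | mul a b ha hb =>
    obtain ⟨C, hC⟩ := ha
    obtain ⟨D, hD⟩ := hb
    refine ⟨C * D, fun B _ T hT => ?_⟩
    rw [map_mul]
    exact (norm_mul_le _ _).trans (mul_le_mul (hC B _ T hT) (hD B _ T hT) (norm_nonneg _)
      ((norm_nonneg _).trans (hC B _ T hT)))
  | add a b ha hb =>
    obtain ⟨C, hC⟩ := ha
    obtain ⟨D, hD⟩ := hb
    refine ⟨C + D, fun B _ T hT => ?_⟩
    rw [map_add]
    exact (norm_add_le _ _).trans (add_le_add (hC B _ T hT) (hD B _ T hT))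

theorem norm_eval_le {B : Type u} [CStarAlgebra B] {T : ι → B} (hT : P.IsRep T)
    (x : FreeStarAlgebra ι) : ‖eval T x‖ ≤ P.univNorm x :=
  le_csSup (P.bddAbove_normValues x) ⟨B, _, T, hT, rfl⟩

theorem univNorm_le {x : FreeStarAlgebra ι} {C : ℝ} (hC : 0 ≤ C)
    (h : ∀ (B : Type u) [CStarAlgebra B] (T : ι → B), P.IsRep T → ‖eval T x‖ ≤ C) :
    P.univNorm x ≤ C := by
  refine Real.sSup_le ?_ hC
  rintro _ ⟨B, _, T, hT, rfl⟩
  exact h B T hT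

theorem univNorm_nonneg (x : FreeStarAlgebra ι) : 0 ≤ P.univNorm x := by
  refine Real.sSup_nonneg ?_
  rintro _ ⟨B, _, T, _, rfl⟩
  exact norm_nonneg _

/-- The free star-algebra on the generators, with the C⋆-seminorm `univNorm`. -/
def Pre (_P : CStarPresentation ι) : Type u := FreeStarAlgebra ι

instance : Ring P.Pre := inferInstanceAs (Ring (FreeStarAlgebra ι))

instance : Algebra ℂ P.Pre := inferInstanceAs (Algebra ℂ (FreeStarAlgebra ι))

instance : StarRing P.Pre := inferInstanceAs (StarRing (FreeStarAlgebra ι))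

instance : StarModule ℂ P.Pre := inferInstanceAs (StarModule ℂ (FreeStarAlgebra ι))

/-- `univNorm` is a ring seminorm. -/
def ringSeminorm : RingSeminorm P.Pre where
  toFun := P.univNorm
  map_zero' := le_antisymm
    (P.univNorm_le le_rfl fun _ _ T _ => (congrArg norm (map_zero (eval T))).trans_le
      norm_zero.le) (P.univNorm_nonneg _)
  add_le' x y := P.univNorm_le (add_nonneg (P.univNorm_nonneg x) (P.univNorm_nonneg y))
    fun B _ T hT => (congrArg norm (map_add (eval T) x y)).trans_le
      ((norm_add_le _ _).trans (add_le_add (P.norm_eval_le hT x) (P.norm_eval_le hT y)))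
  neg' x := congrArg sSup <| Set.ext fun c => exists_congr fun B => exists_congr fun _ =>
    exists_congr fun T => and_congr_right fun _ => by
      rw [show eval T (-x : FreeStarAlgebra ι) = -eval T x from map_neg (eval T) x, norm_neg]
  mul_le' x y := P.univNorm_le (mul_nonneg (P.univNorm_nonneg x) (P.univNorm_nonneg y))
    fun B _ T hT => (congrArg norm (map_mul (eval T) x y)).trans_le
      ((norm_mul_le _ _).trans (mul_le_mul (P.norm_eval_le hT x) (P.norm_eval_le hT y)
        (norm_nonneg _) (P.univNorm_nonneg x)))

instance : SeminormedRing P.Pre := P.ringSeminorm.toSeminormedRing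

theorem norm_smul_pre_le (z : ℂ) (x : P.Pre) : ‖z • x‖ ≤ ‖z‖ * ‖x‖ :=
  P.univNorm_le (mul_nonneg (norm_nonneg z) (P.univNorm_nonneg x)) fun _ _ T hT =>
    (congrArg norm (map_smul (eval T) z (x : FreeStarAlgebra ι))).trans_le
      ((norm_smul_le _ _).trans
        (mul_le_mul_of_nonneg_left (P.norm_eval_le hT x) (norm_nonneg z)))

instance : NormedAlgebra ℂ P.Pre where
  norm_smul_le := P.norm_smul_pre_le

theorem univNorm_star (x : FreeStarAlgebra ι) : P.univNorm (star x) = P.univNorm x := by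
  have h : ∀ y : FreeStarAlgebra ι, P.univNorm (star y) ≤ P.univNorm y := fun y =>
    P.univNorm_le (P.univNorm_nonneg y) fun B _ T hT => by
      rw [map_star, norm_star]
      exact P.norm_eval_le hT y
  refine le_antisymm (h x) ?_
  have := h (star x)
  rwa [star_star] at this

theorem univNorm_mul_self_le (x : FreeStarAlgebra ι) :
    P.univNorm x * P.univNorm x ≤ P.univNorm (star x * x) := by
  have h : P.univNorm x ≤ Real.sqrt (P.univNorm (star x * x)) := by
    refine P.univNorm_le (Real.sqrt_nonneg _) fun B _ T hT => Real.le_sqrt_of_sq_le ?_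
    have h2 := P.norm_eval_le hT (star x * x)
    rwa [map_mul, map_star, CStarRing.norm_star_mul_self, ← sq] at h2
  calc P.univNorm x * P.univNorm x
      ≤ Real.sqrt (P.univNorm (star x * x)) * Real.sqrt (P.univNorm (star x * x)) :=
        mul_self_le_mul_self (P.univNorm_nonneg x) h
    _ = P.univNorm (star x * x) := Real.mul_self_sqrt (P.univNorm_nonneg _)

/-- The universal unital C⋆-algebra `C⋆(G | R)`: the Hausdorff completion of the free star-algebra
with respect to `univNorm`. -/
def Alg : Type u := UniformSpace.Completion P.Pre

instance : NormedRing P.Alg := inferInstanceAs (NormedRing (UniformSpace.Completion P.Pre))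

instance : CompleteSpace P.Alg := inferInstanceAs (CompleteSpace (UniformSpace.Completion P.Pre))

/-- The canonical map from star-polynomials in the generators to `C⋆(G | R)`. -/
def coe (x : FreeStarAlgebra ι) : P.Alg := UniformSpace.Completion.coe' (α := P.Pre) x

instance : Algebra ℂ P.Alg := inferInstanceAs (Algebra ℂ (UniformSpace.Completion P.Pre))

instance : NormedAlgebra ℂ P.Alg where
  norm_smul_le := norm_smul_le (α := ℂ) (β := UniformSpace.Completion P.Pre)

theorem uniformContinuous_star_pre : UniformContinuous (star : P.Pre → P.Pre) :=
  (AddMonoidHomClass.isometry_of_norm (starAddEquiv : P.Pre ≃+ P.Pre)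
    P.univNorm_star).uniformContinuous

instance : Star P.Alg := ⟨UniformSpace.Completion.map (star : P.Pre → P.Pre)⟩

theorem star_coe (x : FreeStarAlgebra ι) : star (P.coe x) = P.coe (star x) :=
  UniformSpace.Completion.map_coe P.uniformContinuous_star_pre x

instance : ContinuousStar P.Alg := ⟨UniformSpace.Completion.continuous_map⟩

theorem coe_add (x y : FreeStarAlgebra ι) : P.coe (x + y) = P.coe x + P.coe y :=
  UniformSpace.Completion.coe_add (α := P.Pre) x y

theorem coe_mul (x y : FreeStarAlgebra ι) : P.coe (x * y) = P.coe x * P.coe y :=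
  UniformSpace.Completion.coe_mul (α := P.Pre) x y

theorem coe_smul (z : ℂ) (x : FreeStarAlgebra ι) : P.coe (z • x) = z • P.coe x :=
  UniformSpace.Completion.coe_smul (X := P.Pre) z x

theorem norm_coe (x : FreeStarAlgebra ι) : ‖P.coe x‖ = P.univNorm x :=
  UniformSpace.Completion.norm_coe (E := P.Pre) x

theorem denseRange_coe : DenseRange P.coe :=
  UniformSpace.Completion.denseRange_coe (α := P.Pre)

instance : StarRing P.Alg where
  star_involutive a := by
    refine P.denseRange_coe.induction_on (p := fun a => star (star a) = a) a
      (isClosed_eq (by fun_prop) (by fun_prop)) fun x => ?_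
    rw [star_coe, star_coe, star_star]
  star_mul a b := by
    refine P.denseRange_coe.induction_on₂ (p := fun a b => star (a * b) = star b * star a)
      (isClosed_eq (by fun_prop) (by fun_prop)) (fun x y => ?_) a b
    rw [← coe_mul, star_coe, star_coe, star_coe, ← coe_mul, star_mul]
  star_add a b := by
    refine P.denseRange_coe.induction_on₂ (p := fun a b => star (a + b) = star a + star b)
      (isClosed_eq (by fun_prop) (by fun_prop)) (fun x y => ?_) a b
    rw [← coe_add, star_coe, star_coe, star_coe, ← coe_add, star_add]

instance : StarModule ℂ P.Alg where
  star_smul z a := by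
    refine P.denseRange_coe.induction_on (p := fun a => star (z • a) = star z • star a) a
      (isClosed_eq (continuous_star.comp (continuous_const_smul z))
        (continuous_star.const_smul (star z))) fun x => ?_
    rw [← coe_smul, star_coe, star_coe, ← coe_smul, star_smul]

instance : CStarRing P.Alg where
  norm_mul_self_le a := by
    refine P.denseRange_coe.induction_on (p := fun a => ‖a‖ * ‖a‖ ≤ ‖star a * a‖) a
      (isClosed_le (by fun_prop) (by fun_prop)) fun x => ?_
    rw [star_coe, ← coe_mul]
    simp only [norm_coe]
    exact P.univNorm_mul_self_le x

instance : CStarAlgebra P.Alg where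

/-- The canonical generators of `C⋆(G | R)`. -/
def gen (i : ι) : P.Alg := P.coe (FreeStarAlgebra.gen i)

end CStarPresentation

/-! ### Quantum automorphism groups and quantum isomorphism of graphs -/

/-- A magic unitary: a matrix of self-adjoint projections all of whose rows and columns
sum to `1`. -/
structure IsMagicUnitary {V : Type*} {W : Type*} [Fintype V] [Fintype W] {A : Type*}
    [Ring A] [StarRing A] (u : Matrix V W A) : Prop where
  isStarProjection : ∀ x y, IsStarProjection (u x y)
  row_sum : ∀ x, ∑ y, u x y = 1
  col_sum : ∀ y, ∑ x, u x y = 1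

namespace SimpleGraph

/-- Two graphs `X` and `Y` are quantum isomorphic if there is a magic unitary `u`, with rows indexed
by the vertices of `X`, columns by the vertices of `Y` and entries in a nonzero unital C⋆-algebra,
such that `A_X u = u A_Y`. -/
def QuantumIsomorphic {V : Type u} {W : Type v} [Fintype V] [Fintype W] (X : SimpleGraph V)
    (Y : SimpleGraph W) : Prop :=
  open Classical in
  ∃ (A : Type (max u v)) (_ : CStarAlgebra A) (w : Matrix V W A),
    Nontrivial A ∧ IsMagicUnitary w ∧ X.adjMatrix A * w = w * Y.adjMatrix A

variable {V : Type u} [Fintype V] (X : SimpleGraph V)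

open FreeStarAlgebra in
/-- The relations defining the quantum automorphism group of `X`, on generators indexed by pairs of
vertices: the generators form a magic unitary, and `u i j * u k l = 0` if `i` and `k` are adjacent
but `j` and `l` are not, or vice versa. -/
inductive QutRel : FreeStarAlgebra (V × V) → Prop
  | idem (i j : V) : QutRel (gen (i, j) * gen (i, j) - gen (i, j))
  | selfAdjoint (i j : V) : QutRel (star (gen (i, j)) - gen (i, j))
  | row (i : V) : QutRel (∑ k, gen (i, k) - 1)
  | col (j : V) : QutRel (∑ k, gen (k, j) - 1)
  | adj_left (i j k l : V) : X.Adj i k → ¬ X.Adj j l → QutRel (gen (i, j) * gen (k, l))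
  | adj_right (i j k l : V) : ¬ X.Adj i k → X.Adj j l → QutRel (gen (i, j) * gen (k, l))

/-- The presentation of `C(Qut(X))`. -/
def qutPresentation : CStarPresentation (V × V) where
  rels := {r | X.QutRel r}
  bounded := fun p => ⟨1, fun B _ T hT => by
    have h1 := hT _ (QutRel.idem p.1 p.2)
    have h2 := hT _ (QutRel.selfAdjoint p.1 p.2)
    rw [map_sub, map_mul, FreeStarAlgebra.eval_gen, sub_eq_zero] at h1
    rw [map_sub, map_star, FreeStarAlgebra.eval_gen, sub_eq_zero] at h2
    exact IsStarProjection.norm_le (T p) ⟨h1, h2⟩⟩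

/-- The unital C⋆-algebra `C(Qut(X))` of the quantum automorphism group of `X`. -/
abbrev CQut : Type u := X.qutPresentation.Alg

/-- The fundamental representation of the quantum automorphism group of `X`, that is, the
generating magic unitary of `C(Qut(X))`. -/
def qutMatrix : Matrix V V X.CQut := fun i j => X.qutPresentation.gen (i, j)

/-- Vertices `i` and `j` lie in the same orbit of the action of `Qut(X)` on the vertices. -/
def SameQuantumOrbit (i j : V) : Prop := X.qutMatrix i j ≠ 0

/-- `X` is quantum vertex transitive if the action of `Qut(X)` on the vertices has a single
orbit. -/
def IsQuantumVertexTransitive : Prop := ∀ i j : V, X.SameQuantumOrbit i j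

end SimpleGraph

end

/-! Let `u` be the generating magic unitary of `C(Qut(Y))`. If `i`, `k` lie in one component and
`j`, `l` do not, then `u i j * u k l = 0`: insert row sums along a walk from `i` to `k`
(`mul_eq_zero_of_reachable`). Hence in the block of `u` with rows in a component `C` and columns in
a component `D`, every row sum and every column sum acts as a two-sided unit on every entry of the
block. Comparing a row sum with a column sum, all of them equal one projection `p`
(`row_sum_component_eq_col_sum`).

The block is thus a magic unitary over the corner `p A p`, whose unit is `p`, and it inherits the
adjacency relations (`exists_component_block`). Transitivity makes its entries, and so `p`, nonzero.
For `C ≠ D` this is a quantum isomorphism; for `C = D` it is a representation of `C(Qut(C))` in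
which no generator vanishes. -/

open Matrix

/-! ### Corners of C⋆-algebras -/

noncomputable section Corner

variable {A : Type u} [CStarAlgebra A] {p : A}

/-- The corner `p A p` of a C⋆-algebra cut out by a projection `p`. -/
def cornerSubalgebra (hp : IsStarProjection p) : NonUnitalStarSubalgebra ℂ A where
  carrier := {x | p * x = x ∧ x * p = x}
  add_mem' := by
    rintro x y ⟨hx, hx'⟩ ⟨hy, hy'⟩
    exact ⟨by rw [mul_add, hx, hy], by rw [add_mul, hx', hy']⟩
  zero_mem' := ⟨mul_zero p, zero_mul p⟩
  mul_mem' := by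
    rintro x y ⟨hx, _⟩ ⟨_, hy'⟩
    exact ⟨by rw [← mul_assoc, hx], by rw [mul_assoc, hy']⟩
  smul_mem' := by
    rintro c x ⟨hx, hx'⟩
    exact ⟨by rw [mul_smul_comm, hx], by rw [smul_mul_assoc, hx']⟩
  star_mem' := by
    rintro x ⟨hx, hx'⟩
    refine ⟨?_, ?_⟩
    · simpa [hp.isSelfAdjoint.star_eq] using congrArg star hx'
    · simpa [hp.isSelfAdjoint.star_eq] using congrArg star hx

/-- The unit is `p` rather than `1`, so the inclusion into `A` is not unital in general; row sums
equal to `p` in `A` become row sums equal to `1` here. -/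
instance (hp : IsStarProjection p) : One (cornerSubalgebra hp) :=
  ⟨⟨p, hp.isIdempotentElem, hp.isIdempotentElem⟩⟩

instance (hp : IsStarProjection p) : CompleteSpace (cornerSubalgebra hp) :=
  have hclosed : IsClosed {x : A | p * x = x ∧ x * p = x} :=
    (isClosed_eq (continuous_const.mul continuous_id) continuous_id).inter
      (isClosed_eq (continuous_id.mul continuous_const) continuous_id)
  hclosed.completeSpace_coe

instance (hp : IsStarProjection p) : NormedRing (cornerSubalgebra hp) where
  __ := (inferInstance : NonUnitalNormedRing (cornerSubalgebra hp))
  one := 1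
  one_mul x := Subtype.ext x.2.1
  mul_one x := Subtype.ext x.2.2

instance (hp : IsStarProjection p) : NormedAlgebra ℂ (cornerSubalgebra hp) where
  __ := Algebra.ofModule (R := ℂ) (A := cornerSubalgebra hp) smul_mul_assoc mul_smul_comm
  norm_smul_le c x := norm_smul_le c (x : A)

instance (hp : IsStarProjection p) : CStarAlgebra (cornerSubalgebra hp) where
  __ := (inferInstance : StarRing (cornerSubalgebra hp))
  star_smul c x := Subtype.ext (star_smul c (x : A))
  norm_mul_self_le x := CStarRing.norm_mul_self_le (x : A)

end Corner

/-! ### Orthogonality in magic unitaries -/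

namespace IsMagicUnitary

variable {V W : Type*} [Fintype V] [Fintype W]

theorem transpose {A : Type*} [Ring A] [StarRing A] {u : Matrix V W A} (hu : IsMagicUnitary u) :
    IsMagicUnitary uᵀ :=
  ⟨fun x y => hu.isStarProjection y x, hu.col_sum, hu.row_sum⟩

/-- Distinct entries of a row of a magic unitary over a C⋆-algebra are orthogonal. -/
theorem mul_eq_zero_of_ne {A : Type*} [CStarAlgebra A] {u : Matrix V W A} (hu : IsMagicUnitary u)
    (x : V) {y z : W} (hyz : y ≠ z) : u x y * u x z = 0 := by
  classical
  let _ := CStarAlgebra.spectralOrder A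
  let _ := CStarAlgebra.spectralOrderedRing A
  have hconj : ∀ w, star (u x w * u x z) * (u x w * u x z) = u x z * u x w * u x z := fun w => by
    rw [star_mul, (hu.isStarProjection x w).isSelfAdjoint.star_eq,
      (hu.isStarProjection x z).isSelfAdjoint.star_eq, mul_assoc, ← mul_assoc (u x w),
      (hu.isStarProjection x w).isIdempotentElem.eq, mul_assoc]
  have hz : u x z * u x z = u x z := (hu.isStarProjection x z).isIdempotentElem.eq
  -- Compressing the row sum by `u x z` gives `u x z` again, and the term `w = z` already accounts
  -- for all of it. The remaining terms are positive by `hconj` and sum to zero, so each vanishes.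
  have htotal : ∑ w, u x z * u x w * u x z = u x z := by
    rw [← Finset.sum_mul, ← Finset.mul_sum, hu.row_sum, mul_one, hz]
  rw [← Finset.add_sum_erase _ _ (Finset.mem_univ z), hz, hz, add_eq_left,
    Finset.sum_eq_zero_iff_of_nonneg fun w _ => hconj w ▸ star_mul_self_nonneg _] at htotal
  rw [← CStarRing.star_mul_self_eq_zero_iff, hconj]
  exact htotal y (Finset.mem_erase.2 ⟨hyz, Finset.mem_univ y⟩)

end IsMagicUnitary

/-! ### Quantum isomorphisms and their blocks -/

namespace SimpleGraph

/-- A magic unitary `u` is a quantum isomorphism from `X` to `Y` if `u i j * u k l = 0` unless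
`i, k` and `j, l` are both adjacent or both non-adjacent. -/
structure IsQuantumIso {V W : Type*} [Fintype V] [Fintype W] {A : Type*} [Ring A] [StarRing A]
    (X : SimpleGraph V) (Y : SimpleGraph W) (u : Matrix V W A) : Prop extends
    IsMagicUnitary u where
  mul_eq_zero : ∀ {i k j l}, ¬ (X.Adj i k ↔ Y.Adj j l) → u i j * u k l = 0

namespace IsQuantumIso

section Basic

variable {V W : Type*} [Fintype V] [Fintype W] {X : SimpleGraph V} {Y : SimpleGraph W}

theorem transpose {A : Type*} [Ring A] [StarRing A] {u : Matrix V W A}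
    (hu : IsQuantumIso X Y u) : IsQuantumIso Y X uᵀ :=
  ⟨hu.toIsMagicUnitary.transpose, fun h => hu.mul_eq_zero fun h' => h h'.symm⟩

-- Both sides have `(i, j)` entry equal to the sum of `u k j * u i l` over neighbours `k` of `i` and
-- `l` of `j`: insert row `i` on the left and column `j` on the right, and drop the products killed
-- by the adjacency relations.
open Classical in
theorem adjMatrix_mul {A : Type*} [Ring A] [StarRing A] {u : Matrix V W A}
    (hu : IsQuantumIso X Y u) : X.adjMatrix A * u = u * Y.adjMatrix A := by
  ext i j
  have h1 : ∀ k, (if X.Adj i k then u k j else 0)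
      = ∑ l, if X.Adj i k ∧ Y.Adj j l then u k j * u i l else 0 := fun k => by
    split_ifs with h
    · conv_lhs => rw [← mul_one (u k j), ← hu.row_sum i, Finset.mul_sum]
      refine Finset.sum_congr rfl fun l _ => ?_
      split_ifs with h'
      · rfl
      · exact hu.mul_eq_zero fun h'' => h' ⟨h, h''.1 h.symm⟩
    · simp [h]
  have h2 : ∀ l, (if Y.Adj l j then u i l else 0)
      = ∑ k, if X.Adj i k ∧ Y.Adj j l then u k j * u i l else 0 := fun l => by
    split_ifs with h
    · conv_lhs => rw [← one_mul (u i l), ← hu.col_sum j, Finset.sum_mul]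
      refine Finset.sum_congr rfl fun k _ => ?_
      split_ifs with h'
      · rfl
      · exact hu.mul_eq_zero fun h'' => h' ⟨(h''.2 h.symm).symm, h.symm⟩
    · simp [Y.adj_comm j l, h]
  simp only [Matrix.mul_apply, adjMatrix_apply, ite_mul, one_mul, zero_mul, mul_ite, mul_one,
    mul_zero]
  rw [Finset.sum_congr rfl fun k _ => h1 k, Finset.sum_congr rfl fun l _ => h2 l,
    Finset.sum_comm]

variable {A : Type*} [CStarAlgebra A] {u : Matrix V W A} (hu : IsQuantumIso X Y u)
include hu

theorem mul_eq_zero_of_reachable {i k : V} {j l : W} (hik : X.Reachable i k)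
    (hjl : ¬ Y.Reachable j l) : u i j * u k l = 0 := by
  obtain ⟨p⟩ := hik
  induction p generalizing j with
  | nil => exact hu.mul_eq_zero_of_ne _ fun h => hjl (h ▸ Reachable.refl j)
  | @cons i i' k h p ih =>
    -- Insert the row of the next vertex `i'` of the walk. A term with `m` adjacent to `j` dies by
    -- induction, since `m` is still not connected to `l`; any other term dies because `i` and `i'`
    -- are adjacent.
    rw [← mul_one (u i j), ← hu.row_sum i', Finset.mul_sum, Finset.sum_mul]
    refine Finset.sum_eq_zero fun m _ => ?_
    by_cases hm : Y.Adj j m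
    · rw [mul_assoc, ih fun h' => hjl (hm.reachable.trans h'), mul_zero]
    · rw [hu.mul_eq_zero fun h' => hm (h'.1 h), zero_mul]

/-- Terms with `j` outside `D` annihilate `u k l`, so the partial row sum may be completed to the
full row sum `1`. -/
theorem row_sum_component_mul {D : Y.ConnectedComponent} [Fintype D] {i k : V} {l : W}
    (hik : X.Reachable i k) (hl : l ∈ D) : (∑ j : D, u i j) * u k l = u k l := by
  rw [Finset.sum_mul, Fintype.sum_of_injective ((↑) : D → W) Subtype.val_injective _
    (fun j => u i j * u k l) (fun j hj => hu.mul_eq_zero_of_reachable hik fun h => hj ?_)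
    (fun _ => rfl), ← Finset.sum_mul, hu.row_sum, one_mul]
  exact ⟨⟨j, (ConnectedComponent.sound h).trans hl⟩, rfl⟩

theorem mul_row_sum_component {D : Y.ConnectedComponent} [Fintype D] {i k : V} {l : W}
    (hik : X.Reachable i k) (hl : l ∈ D) : u k l * ∑ j : D, u i j = u k l := by
  rw [Finset.mul_sum, Fintype.sum_of_injective ((↑) : D → W) Subtype.val_injective _
    (fun j => u k l * u i j) (fun j hj => hu.mul_eq_zero_of_reachable hik.symm fun h => hj ?_)
    (fun _ => rfl), ← Finset.mul_sum, hu.row_sum, mul_one]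
  exact ⟨⟨j, (ConnectedComponent.sound h.symm).trans hl⟩, rfl⟩

/-- The row sums and column sums of a block of `u` indexed by components all agree. -/
theorem row_sum_component_eq_col_sum {C : X.ConnectedComponent} {D : Y.ConnectedComponent}
    [Fintype C] [Fintype D] (i : C) (j : D) : ∑ l : D, u i l = ∑ k : C, u k j := by
  -- The product is evaluated in two ways: the column sum absorbs into each entry of the row (by
  -- transposition), and the row sum into each entry of the column.
  have h1 : (∑ l : D, u i l) * ∑ k : C, u k j = ∑ l : D, u i l := by
    rw [Finset.sum_mul]
    exact Finset.sum_congr rfl fun l _ => hu.transpose.mul_row_sum_component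
      (ConnectedComponent.exact (j.2.trans l.2.symm)) i.2
  have h2 : (∑ l : D, u i l) * ∑ k : C, u k j = ∑ k : C, u k j := by
    rw [Finset.mul_sum]
    exact Finset.sum_congr rfl fun k _ => hu.row_sum_component_mul
      (ConnectedComponent.exact (i.2.trans k.2.symm)) j.2
  exact h1.symm.trans h2

end Basic

/-- A nonzero block of a quantum isomorphism, indexed by connected components, is a quantum
isomorphism of these components over a corner of the original C⋆-algebra. -/
theorem exists_component_block {V W : Type*} [Fintype V] [Fintype W] {X : SimpleGraph V}
    {Y : SimpleGraph W} {A : Type u} [CStarAlgebra A] {u : Matrix V W A}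
    (hu : IsQuantumIso X Y u) (C : X.ConnectedComponent) (D : Y.ConnectedComponent)
    [Fintype C] [Fintype D] (hne : ∃ (i : C) (j : D), u i j ≠ 0) :
    ∃ (B : Type u) (_ : CStarAlgebra B) (w : Matrix C D B), Nontrivial B ∧
      IsQuantumIso C.toSimpleGraph D.toSimpleGraph w ∧ ∀ i j, w i j = 0 → u i j = 0 := by
  obtain ⟨i₀, j₀, h₀⟩ := hne
  have hrow : ∀ i : C, ∑ l : D, u i l = ∑ l : D, u i₀ l := fun i =>
    (hu.row_sum_component_eq_col_sum i j₀).trans (hu.row_sum_component_eq_col_sum i₀ j₀).symm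
  have hcol : ∀ j : D, ∑ k : C, u k j = ∑ l : D, u i₀ l := fun j =>
    (hu.row_sum_component_eq_col_sum i₀ j).symm
  set p := ∑ l : D, u i₀ l with hp_def
  have hpu : ∀ (i : C) (j : D), p * u i j = u i j := fun i j =>
    hu.row_sum_component_mul (ConnectedComponent.exact (i₀.2.trans i.2.symm)) j.2
  have hup : ∀ (i : C) (j : D), u i j * p = u i j := fun i j =>
    hu.mul_row_sum_component (ConnectedComponent.exact (i₀.2.trans i.2.symm)) j.2
  have hp : IsStarProjection p := by
    -- Idempotence holds because `p` is a sum of entries, each fixed by multiplication by `p`.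
    refine ⟨?_, ?_⟩
    · change p * p = p
      conv_lhs => rw [hp_def, Finset.sum_mul]
      exact Finset.sum_congr rfl fun l _ => hup i₀ l
    · change star p = p
      rw [hp_def, star_sum]
      exact Finset.sum_congr rfl fun l _ => (hu.isStarProjection _ _).isSelfAdjoint
  let w : Matrix C D (cornerSubalgebra hp) := fun i j => ⟨u i j, hpu i j, hup i j⟩
  let incl := NonUnitalStarSubalgebraClass.subtype (cornerSubalgebra hp)
  refine ⟨cornerSubalgebra hp, inferInstance, w, ⟨w i₀ j₀, 0, fun h => h₀ congr(($h : A))⟩,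
    ⟨⟨fun i j => ⟨?_, ?_⟩, fun i => ?_, fun j => ?_⟩, fun {i k j l} h => ?_⟩,
    fun i j h => congr(($h : A))⟩
  · exact Subtype.ext (hu.isStarProjection i j).isIdempotentElem
  · exact Subtype.ext (hu.isStarProjection i j).isSelfAdjoint
  · exact Subtype.ext ((map_sum incl (w i) Finset.univ).trans (hrow i))
  · exact Subtype.ext ((map_sum incl (fun i => w i j) Finset.univ).trans (hcol j))
  · exact Subtype.ext (hu.mul_eq_zero h)

end IsQuantumIso

/-! ### Representations of the universal algebra -/

section Qut

variable {V : Type u} [Fintype V] (X : SimpleGraph V)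

/-- Serves in both directions: it yields the relations for the canonical generators, and it lets a
block over a corner be used as a representation. -/
theorem qutPresentation_isRep_iff {B : Type v} [CStarAlgebra B] (w : Matrix V V B) :
    X.qutPresentation.IsRep (fun p : V × V => w p.1 p.2) ↔ IsQuantumIso X X w := by
  constructor
  · intro h
    refine ⟨⟨fun i j => ⟨?_, ?_⟩, fun i => ?_, fun j => ?_⟩, fun {i k j l} hadj => ?_⟩
    · simpa [FreeStarAlgebra.eval_gen, sub_eq_zero, IsIdempotentElem] using h _ (.idem i j)
    · have := h _ (.selfAdjoint i j)
      rwa [map_sub, map_star, FreeStarAlgebra.eval_gen, sub_eq_zero] at this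
    · simpa [FreeStarAlgebra.eval_gen, sub_eq_zero] using h _ (.row i)
    · simpa [FreeStarAlgebra.eval_gen, sub_eq_zero] using h _ (.col j)
    · by_cases hik : X.Adj i k
      · simpa [FreeStarAlgebra.eval_gen] using
          h _ (.adj_left i j k l hik fun hjl => hadj ⟨fun _ => hjl, fun _ => hik⟩)
      · simpa [FreeStarAlgebra.eval_gen] using
          h _ (.adj_right i j k l hik (by tauto))
  · rintro h _ (⟨i, j⟩ | ⟨i, j⟩ | i | j | ⟨i, j, k, l, h1, h2⟩ | ⟨i, j, k, l, h1, h2⟩)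
    · simpa [FreeStarAlgebra.eval_gen, sub_eq_zero] using
        (h.isStarProjection i j).isIdempotentElem.eq
    · rw [map_sub, map_star, FreeStarAlgebra.eval_gen, sub_eq_zero]
      exact (h.isStarProjection i j).isSelfAdjoint
    · simpa [FreeStarAlgebra.eval_gen, sub_eq_zero] using h.row_sum i
    · simpa [FreeStarAlgebra.eval_gen, sub_eq_zero] using h.col_sum j
    · simpa [FreeStarAlgebra.eval_gen] using h.mul_eq_zero fun h' => h2 (h'.1 h1)
    · simpa [FreeStarAlgebra.eval_gen] using h.mul_eq_zero fun h' => h1 (h'.2 h2)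

variable {X} in
/-- A generator of `C(Qut(X))` with a nonzero image in some representation is nonzero. -/
theorem IsQuantumIso.sameQuantumOrbit {B : Type u} [CStarAlgebra B] {w : Matrix V V B}
    (hw : IsQuantumIso X X w) {i j : V} (hij : w i j ≠ 0) : X.SameQuantumOrbit i j := by
  intro h
  -- The universal norm dominates the norm in every representation, so a vanishing generator would
  -- force `w i j = 0`.
  have hle := X.qutPresentation.norm_eval_le ((X.qutPresentation_isRep_iff w).2 hw)
    (FreeStarAlgebra.gen (i, j))
  have hzero : ‖X.qutPresentation.coe (FreeStarAlgebra.gen (i, j))‖ = 0 :=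
    norm_eq_zero.2 h
  rw [FreeStarAlgebra.eval_gen, ← CStarPresentation.norm_coe, hzero] at hle
  exact hij (norm_le_zero_iff.1 hle)

/-- Both sides respect the algebra operations and agree on letters; this reduces the relations for
`P.gen` to a computation of `univNorm`. -/
theorem _root_.CStarPresentation.eval_gen_eq_coe {ι : Type u} (P : CStarPresentation ι)
    (x : FreeStarAlgebra ι) : FreeStarAlgebra.eval P.gen x = P.coe x := by
  induction x using FreeStarAlgebra.induction with
  | scalar z =>
    rw [Algebra.algebraMap_eq_smul_one, map_smul, map_one, P.coe_smul]
    rfl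
  | letter s =>
    rw [FreeStarAlgebra.eval_letter]
    cases s with
    | inl i => rfl
    | inr i =>
      change star (P.coe _) = _
      rw [P.star_coe, FreeStarAlgebra.gen, FreeStarAlgebra.star_letter]
      rfl
  | mul a b ha hb => rw [map_mul, ha, hb, P.coe_mul]
  | add a b ha hb => rw [map_add, ha, hb, P.coe_add]

/-- The generators of a universal C⋆-algebra satisfy its relations. -/
theorem _root_.CStarPresentation.isRep_gen {ι : Type u} (P : CStarPresentation ι) :
    P.IsRep P.gen := fun r hr => by
  rw [P.eval_gen_eq_coe, ← norm_eq_zero, P.norm_coe]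
  exact le_antisymm (P.univNorm_le le_rfl fun B _ T hT => by rw [hT r hr, norm_zero])
    (P.univNorm_nonneg r)

theorem isQuantumIso_qutMatrix : IsQuantumIso X X X.qutMatrix :=
  (X.qutPresentation_isRep_iff X.qutMatrix).1 X.qutPresentation.isRep_gen

end Qut

/-! ### Decomposition into components and the conclusion -/

theorem top_eq_iSup_induce_supp {V : Type*} (X : SimpleGraph V) :
    (⊤ : X.Subgraph) = ⨆ C : X.ConnectedComponent, (⊤ : X.Subgraph).induce C.supp := by
  ext a b
  · simp
  · simp only [Subgraph.top_adj, Subgraph.iSup_adj, Subgraph.induce_adj]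
    exact ⟨fun h => ⟨X.connectedComponentMk a, rfl, ConnectedComponent.sound h.symm.reachable, h⟩,
      fun ⟨_, _, _, h⟩ => h⟩

end SimpleGraph

theorem mainTheorem8 {V : Type u} [Fintype V] (Y : SimpleGraph V)
    [∀ C : Y.ConnectedComponent, Fintype C]
    (hdisc : ¬ Y.Connected) (hY : Y.IsQuantumVertexTransitive) :
    ((⊤ : Y.Subgraph) = ⨆ C : Y.ConnectedComponent, (⊤ : Y.Subgraph).induce C.supp) ∧
    (∀ C : Y.ConnectedComponent, C.toSimpleGraph.IsQuantumVertexTransitive) ∧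
    (∀ C D : Y.ConnectedComponent, C ≠ D →
      C.toSimpleGraph.QuantumIsomorphic D.toSimpleGraph) := by
  -- `C = D` is allowed here: diagonal blocks give transitivity, off-diagonal ones quantum
  -- isomorphism. Any choice of representatives works, as every entry is nonzero.
  have hblock := fun C D : Y.ConnectedComponent =>
    Y.isQuantumIso_qutMatrix.exists_component_block C D
      ⟨⟨_, C.nonempty_supp.choose_spec⟩, ⟨_, D.nonempty_supp.choose_spec⟩, hY _ _⟩
  refine ⟨Y.top_eq_iSup_induce_supp, fun C i j => ?_, fun C D _ => ?_⟩
  · obtain ⟨B, _, w, _, hw, hzero⟩ := hblock C C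
    exact hw.sameQuantumOrbit fun h => hY i j (hzero i j h)
  · obtain ⟨B, _, w, hB, hw, -⟩ := hblock C D
    exact ⟨B, _, w, hB, hw.toIsMagicUnitary, hw.adjMatrix_mul⟩
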